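/- Let $(S,\psi_S)$ be a complete separable metric space with its Borel $\sigma$-algebra, and let $V:S\to\mathbb{R}$ be a lower semi-continuous function with $\inf_S V>0$. Let $\mathcal{P}_V(S)$ be the set of probability measures $\mu$ on $S$ with $\mu(V)=\int V\,d\mu<\infty$. Let $P(x,dy)$ be a Markov kernel on $S$ which is a $V$-operator, that is, $\sup_{x\in S}P(V)(x)/V(x)<\infty$ with $P(V)(x)=\int P(x,dy)\,V(y)$, and write $(\mu P)(dy)=\int\mu(dx)\,P(x,dy)$. A $V$-semi-distance is a lower semi-continuous function $\phi:S^2\to[0,\infty)$ such that $\phi(x,y)=0$ if and only if $x=y$, and $\sup_{x,y\in S}\phi(x,y)/(V(x)+V(y))<\infty$. For such $\phi$ and probability measures $\mu_1,\mu_2$ on $S$ put $$D_\phi(\mu_1,\mu_2)=\inf_{\pi}\int\phi(x,y)\,\pi(d(x,y)),$$ where the infimum is over all probability measures $\pi$ on $S^2$ with first marginal $\mu_1$ and second marginal $\mu_2$. The $\phi$-Dobrushin coefficient of $P$ is $$\beta_\phi(P)=\sup\left\{\frac{D_\phi(\mu_1P,\mu_2P)}{D_\phi(\mu_1,\mu_2)}~:~\mu_1,\mu_2\in\mathcal{P}_V(S),\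 D_\phi(\mu_1,\mu_2)>0\right\}\in[0,\infty],$$ with the convention $\sup\emptyset=0$. Let $\varphi$ be a $V$-semi-distance. Then: 1. For all $a>0$ and $\iota\in(0,1]$, $$\beta_{a\varphi}(P)=\beta_\varphi(P)\quad\text{and}\quad\beta_{\varphi^\iota}(P)\le\beta_\varphi(P)^\iota .$$ 2. For every $V$-semi-distance $\psi$ and all constants $0<a\le b$, $$a\varphi\le\psi\le b\varphi\ \Longrightarrow\ \beta_\varphi(P)\le\frac{b}{a}\,\beta_\psi(P).$$ 3. Let $\psi$ be a $V$-semi-distance with $\varphi\le\psi$ and $\beta_\psi(P)<1$. For all $\iota\ge0$ and $\delta\in(0,1)$, $$\beta_\psi(P)<\frac{\delta}{1+\iota}\ \Longrightarrow\ \beta_{\iota\varphi+\psi}(P)\le\delta .$$ In particular, for $0\le\iota\le1-\beta_\psi(P)$, $$\beta_{\iota\varphi+\psi}(P)\le1-\bigl(1-\beta_\psi(P)\bigr)^2 .$$ -/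

import Mathlib

open MeasureTheory ProbabilityTheory
open scoped ENNReal NNReal

noncomputable section

namespace KantorovichContraction

/-- The standing assumption on the weight function `V`: it is a real-valued lower semi-continuous
function which is bounded below away from zero. -/
structure IsWeight {S : Type*} [TopologicalSpace S] (V : S → ℝ) : Prop where
  lsc : LowerSemicontinuous V
  bddBelow_pos : ∃ c : ℝ, 0 < c ∧ ∀ x, c ≤ V x

/-- Semi-distances on `S`: non-negative lower semi-continuous functions on `S × S` that vanish
exactly on the diagonal (neither symmetry nor the triangle inequality is required). -/
structure IsSemiDistance {S : Type*} [TopologicalSpace S] (φ : S × S → ℝ) : Prop where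
  nonneg : ∀ z, 0 ≤ φ z
  eq_zero_iff : ∀ x y, φ (x, y) = 0 ↔ x = y
  lsc : LowerSemicontinuous φ

/-- `V`-semi-distances: semi-distances `φ` such that the uniform norm of
`φ (x, y) / (V x + V y)` is finite. -/
structure IsVSemiDistance {S : Type*} [TopologicalSpace S] (V : S → ℝ) (φ : S × S → ℝ) : Prop
    extends IsSemiDistance φ where
  bound : ∃ C : ℝ, ∀ x y, φ (x, y) ≤ C * (V x + V y)

/-- `P` is a `V`-operator: the uniform norm of `P(V) / V` is finite. -/
def IsVOperator {S : Type*} [MeasurableSpace S] (V : S → ℝ) (P : Kernel S S) : Prop :=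
  ∃ C : ℝ≥0, ∀ x, ∫⁻ y, ENNReal.ofReal (V y) ∂(P x) ≤ C * ENNReal.ofReal (V x)

/-- The probability measures `μ` on `S` with `μ(V) < ∞`. -/
def probV {S : Type*} [MeasurableSpace S] (V : S → ℝ) : Set (Measure S) :=
  {μ | IsProbabilityMeasure μ ∧ ∫⁻ x, ENNReal.ofReal (V x) ∂μ < ∞}

/-- The couplings of `μ₁` and `μ₂`: probability measures on `S × S` with first marginal `μ₁` and
second marginal `μ₂`. -/
def couplings {S : Type*} [MeasurableSpace S] (μ₁ μ₂ : Measure S) : Set (Measure (S × S)) :=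
  {π | IsProbabilityMeasure π ∧ π.fst = μ₁ ∧ π.snd = μ₂}

/-- The Kantorovich semi-distance `D_φ(μ₁, μ₂)`, with values in `[0, ∞]`. -/
def kantorovich {S : Type*} [MeasurableSpace S] (φ : S × S → ℝ) (μ₁ μ₂ : Measure S) : ℝ≥0∞ :=
  ⨅ π ∈ couplings μ₁ μ₂, ∫⁻ z, ENNReal.ofReal (φ z) ∂π

/-- The `(ψ, φ)`-Dobrushin contraction coefficient of `P`, with values in `[0, ∞]`. The measure
`μ.bind P` is `μP`. For `V`-semi-distances the denominators are finite on the range of the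
supremum. -/
def dobrushin₂ {S : Type*} [MeasurableSpace S] (V : S → ℝ) (P : Kernel S S)
    (ψ φ : S × S → ℝ) : ℝ≥0∞ :=
  ⨆ (μ₁ ∈ probV V) (μ₂ ∈ probV V) (_ : 0 < kantorovich ψ μ₁ μ₂),
    kantorovich φ (μ₁.bind P) (μ₂.bind P) / kantorovich ψ μ₁ μ₂

/-- The `φ`-Dobrushin contraction coefficient of `P`. -/
def dobrushin {S : Type*} [MeasurableSpace S] (V : S → ℝ) (P : Kernel S S)
    (φ : S × S → ℝ) : ℝ≥0∞ :=
  dobrushin₂ V P φ φ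

end KantorovichContraction

end

/-! A pointwise comparison of costs passes to $D$, so $a\varphi\le\psi\le b\varphi$ costs a factor
$b/a$ (`dobrushin_le_of_equiv`). Scaling is the case $a=b$, and item 3 is the comparison
$\psi\le\iota\varphi+\psi\le(1+\iota)\psi$.

The power bound is the hard part. Jensen bounds $D_{\varphi^\iota}$ by $D_\varphi^\iota$, which
helps after applying $P$ but has the wrong direction before. The loss is small when $\varphi$ is
nearly constant on the coupling. Hence a coupling is cut into level sets
$e^{kt}\le\varphi<e^{(k+1)t}$ and the diagonal; each normalized level piece is transported at rate
almost $\beta_\varphi(P)$ (`exists_transport_of_level`), and the pieces are summed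
(`kantorovich_bind_le_of_pieces`). The error factor $e^t$ tends to 1. A piece may have equal
marginals although $\varphi>0$ on it, so $D_\varphi=0$ must imply equality of measures
(`eq_of_kantorovich_eq_zero`). -/

open Set

namespace KantorovichContraction

/-! ### Couplings, comparison of costs and gluing -/

section Couplings

variable {S : Type*} [MeasurableSpace S]

/-- The image of a probability measure under the diagonal map couples it with itself. -/
lemma kantorovich_self_eq_zero {φ : S × S → ℝ} (hφ : Measurable φ) (h0 : ∀ x, φ (x, x) = 0)
    (μ : Measure S) [IsProbabilityMeasure μ] : kantorovich φ μ μ = 0 := by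
  have hm : Measurable fun x : S => (x, x) := measurable_id.prodMk measurable_id
  refine le_antisymm ?_ zero_le
  have hπ : μ.map (fun x => (x, x)) ∈ couplings μ μ := by
    refine ⟨Measure.isProbabilityMeasure_map hm.aemeasurable, ?_, ?_⟩
    · rw [Measure.fst, Measure.map_map measurable_fst hm]; exact Measure.map_id
    · rw [Measure.snd, Measure.map_map measurable_snd hm]; exact Measure.map_id
  refine (iInf₂_le _ hπ).trans ?_
  rw [lintegral_map hφ.ennreal_ofReal hm]
  simp [h0]

/-- Dividing by `K` moves it across the infimum; `K ≠ 0` matters because an empty infimum is `∞` and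
`0 * ∞ = 0`. -/
lemma le_mul_kantorovich {ψ : S × S → ℝ} {μ₁ μ₂ : Measure S} {K D : ℝ≥0∞} (hK : K ≠ 0)
    (hK' : K ≠ ∞) (h : ∀ π ∈ couplings μ₁ μ₂, D ≤ K * ∫⁻ z, ENNReal.ofReal (ψ z) ∂π) :
    D ≤ K * kantorovich ψ μ₁ μ₂ := by
  rw [← ENNReal.div_le_iff' hK hK']
  exact le_iInf₂ fun π hπ => (ENNReal.div_le_iff' hK hK').2 (h π hπ)

lemma kantorovich_le_mul_of_le {φ ψ : S × S → ℝ} {c : ℝ} (hc : 0 < c)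
    (h : ∀ z, φ z ≤ c * ψ z) (μ₁ μ₂ : Measure S) :
    kantorovich φ μ₁ μ₂ ≤ ENNReal.ofReal c * kantorovich ψ μ₁ μ₂ := by
  refine le_mul_kantorovich (by simpa using hc) ENNReal.ofReal_ne_top fun π hπ => ?_
  refine (iInf₂_le π hπ).trans ?_
  rw [← lintegral_const_mul' _ _ ENNReal.ofReal_ne_top]
  refine lintegral_mono fun z => ?_
  rw [← ENNReal.ofReal_mul hc.le]
  exact ENNReal.ofReal_le_ofReal (h z)

lemma lintegral_coupling_lt_top {V : S → ℝ} (hV : Measurable V) (hV0 : ∀ x, 0 ≤ V x)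
    {φ : S × S → ℝ} {C : ℝ} (hC : ∀ x y, φ (x, y) ≤ C * (V x + V y)) {μ₁ μ₂ : Measure S}
    (h₁ : μ₁ ∈ probV V) (h₂ : μ₂ ∈ probV V) {π : Measure (S × S)} (hπ : π ∈ couplings μ₁ μ₂) :
    ∫⁻ z, ENNReal.ofReal (φ z) ∂π < ∞ := by
  have hle : ∀ z : S × S, ENNReal.ofReal (φ z) ≤
      ENNReal.ofReal |C| * (ENNReal.ofReal (V z.1) + ENNReal.ofReal (V z.2)) := by
    rintro ⟨x, y⟩
    rw [← ENNReal.ofReal_add (hV0 x) (hV0 y), ← ENNReal.ofReal_mul (abs_nonneg C)]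
    exact ENNReal.ofReal_le_ofReal ((hC x y).trans
      (mul_le_mul_of_nonneg_right (le_abs_self C) (add_nonneg (hV0 x) (hV0 y))))
  refine (lintegral_mono hle).trans_lt ?_
  have e₁ : ∫⁻ z, ENNReal.ofReal (V z.1) ∂π = ∫⁻ x, ENNReal.ofReal (V x) ∂μ₁ := by
    rw [← hπ.2.1, Measure.fst, lintegral_map hV.ennreal_ofReal measurable_fst]
  have e₂ : ∫⁻ z, ENNReal.ofReal (V z.2) ∂π = ∫⁻ x, ENNReal.ofReal (V x) ∂μ₂ := by
    rw [← hπ.2.2, Measure.snd, lintegral_map hV.ennreal_ofReal measurable_snd]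
  have hm : Measurable fun z : S × S => ENNReal.ofReal (V z.1) :=
    hV.ennreal_ofReal.comp measurable_fst
  rw [lintegral_const_mul' _ _ ENNReal.ofReal_ne_top,
    lintegral_add_left hm, e₁, e₂]
  exact ENNReal.mul_lt_top ENNReal.ofReal_lt_top (ENNReal.add_lt_top.2 ⟨h₁.2, h₂.2⟩)

lemma kantorovich_lt_top {V : S → ℝ} (hV : Measurable V) (hV0 : ∀ x, 0 ≤ V x)
    {φ : S × S → ℝ} {C : ℝ} (hC : ∀ x y, φ (x, y) ≤ C * (V x + V y)) {μ₁ μ₂ : Measure S}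
    (h₁ : μ₁ ∈ probV V) (h₂ : μ₂ ∈ probV V) : kantorovich φ μ₁ μ₂ < ∞ := by
  have := h₁.1
  have := h₂.1
  have hπ : μ₁.prod μ₂ ∈ couplings μ₁ μ₂ :=
    ⟨inferInstance, by simp [Measure.fst_prod], by simp [Measure.snd_prod]⟩
  exact (iInf₂_le _ hπ).trans_lt (lintegral_coupling_lt_top hV hV0 hC h₁ h₂ hπ)

lemma kantorovich_bind_le_dobrushin_mul {V : S → ℝ} {P : Kernel S S} {φ : S × S → ℝ}
    {μ₁ μ₂ : Measure S} (h₁ : μ₁ ∈ probV V) (h₂ : μ₂ ∈ probV V)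
    (h0 : kantorovich φ μ₁ μ₂ ≠ 0) (htop : kantorovich φ μ₁ μ₂ ≠ ∞) :
    kantorovich φ (μ₁.bind P) (μ₂.bind P) ≤ dobrushin V P φ * kantorovich φ μ₁ μ₂ := by
  rw [← ENNReal.div_le_iff h0 htop]
  exact le_iSup₂_of_le μ₁ h₁ (le_iSup₂_of_le μ₂ h₂
    (le_iSup_of_le (pos_iff_ne_zero.2 h0) le_rfl))

lemma dobrushin_le {V : S → ℝ} {P : Kernel S S} {φ : S × S → ℝ} {K : ℝ≥0∞}
    (h : ∀ μ₁ ∈ probV V, ∀ μ₂ ∈ probV V, 0 < kantorovich φ μ₁ μ₂ →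
      kantorovich φ (μ₁.bind P) (μ₂.bind P) ≤ K * kantorovich φ μ₁ μ₂) :
    dobrushin V P φ ≤ K :=
  iSup₂_le fun μ₁ h₁ => iSup₂_le fun μ₂ h₂ => iSup_le fun h0 =>
    ENNReal.div_le_of_le_mul (h μ₁ h₁ μ₂ h₂ h0)

/-- Equivalent costs have comparable contraction coefficients. -/
lemma dobrushin_le_of_equiv {V : S → ℝ} (hV : Measurable V) (hV0 : ∀ x, 0 ≤ V x)
    (P : Kernel S S) {φ ψ : S × S → ℝ} {C : ℝ} (hC : ∀ x y, ψ (x, y) ≤ C * (V x + V y))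
    {a b : ℝ} (ha : 0 < a) (hb : 0 < b) (hl : ∀ z, a * φ z ≤ ψ z) (hu : ∀ z, ψ z ≤ b * φ z) :
    dobrushin V P φ ≤ ENNReal.ofReal (b / a) * dobrushin V P ψ := by
  have hl' : ∀ z, φ z ≤ a⁻¹ * ψ z := fun z => by
    rw [inv_mul_eq_div, le_div_iff₀' ha]; exact hl z
  refine dobrushin_le fun μ₁ h₁ μ₂ h₂ h0 => ?_
  -- The comparison itself makes the pair admissible in the supremum for `ψ`, without any separation
  -- property.
  have hne : kantorovich ψ μ₁ μ₂ ≠ 0 := fun h => by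
    have := kantorovich_le_mul_of_le (inv_pos.2 ha) hl' μ₁ μ₂
    rw [h, mul_zero] at this
    exact absurd h0 (not_lt.2 this)
  calc kantorovich φ (μ₁.bind P) (μ₂.bind P)
      ≤ ENNReal.ofReal a⁻¹ * kantorovich ψ (μ₁.bind P) (μ₂.bind P) :=
        kantorovich_le_mul_of_le (inv_pos.2 ha) hl' _ _
    _ ≤ ENNReal.ofReal a⁻¹ * (dobrushin V P ψ * kantorovich ψ μ₁ μ₂) := by
        gcongr
        exact kantorovich_bind_le_dobrushin_mul h₁ h₂ hne (kantorovich_lt_top hV hV0 hC h₁ h₂).ne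
    _ ≤ ENNReal.ofReal a⁻¹ * (dobrushin V P ψ * (ENNReal.ofReal b * kantorovich φ μ₁ μ₂)) := by
        gcongr
        exact kantorovich_le_mul_of_le hb hu _ _
    _ = ENNReal.ofReal (b / a) * dobrushin V P ψ * kantorovich φ μ₁ μ₂ := by
        rw [div_eq_mul_inv, mul_comm b, ENNReal.ofReal_mul (inv_nonneg.2 ha.le)]
        ring

/-- Jensen's inequality for the Kantorovich cost of a concave power. -/
lemma kantorovich_rpow_le {φ : S × S → ℝ} (hφ : Measurable φ) (h0 : ∀ z, 0 ≤ φ z) {ι : ℝ}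
    (hι : 0 < ι) (hι' : ι ≤ 1) (μ₁ μ₂ : Measure S) :
    kantorovich (fun z => φ z ^ ι) μ₁ μ₂ ≤ kantorovich φ μ₁ μ₂ ^ ι := by
  rw [← ENNReal.rpow_inv_le_iff hι]
  refine le_iInf₂ fun π hπ => ?_
  have := hπ.1
  -- Jensen, as monotonicity of $L^p$ seminorms in the exponent on a probability space.
  have h := eLpNorm'_le_eLpNorm'_of_exponent_le hι hι' π hφ.aestronglyMeasurable
  simp only [eLpNorm', ENNReal.rpow_one, one_div, inv_one] at h
  have e : ∀ z, ‖φ z‖ₑ = ENNReal.ofReal (φ z) := fun z => Real.enorm_of_nonneg (h0 z)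
  simp only [e] at h
  refine le_trans ?_ h
  gcongr
  refine (iInf₂_le π hπ).trans (lintegral_mono fun z => ?_)
  rw [ENNReal.ofReal_rpow_of_nonneg (h0 z) hι.le]

/-- A coupling cut into countably many pieces, each transported with cost controlled by its own
cost, yields a coupling of the transported marginals. -/
lemma kantorovich_bind_le_of_pieces {J : Type*} [Countable J] [MeasurableSpace J]
    [MeasurableSingletonClass J] {L : S × S → J} (hL : Measurable L) {P : Kernel S S}
    [IsMarkovKernel P] {ψ : S × S → ℝ} {K : ℝ≥0∞} {μ₁ μ₂ : Measure S} {π : Measure (S × S)}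
    (hπ : π ∈ couplings μ₁ μ₂)
    (h : ∀ j, ∃ γ : Measure (S × S), γ.fst = (π.restrict (L ⁻¹' {j})).fst.bind P ∧
      γ.snd = (π.restrict (L ⁻¹' {j})).snd.bind P ∧
      ∫⁻ z, ENNReal.ofReal (ψ z) ∂γ ≤ K * ∫⁻ z in L ⁻¹' {j}, ENNReal.ofReal (ψ z) ∂π) :
    kantorovich ψ (μ₁.bind P) (μ₂.bind P) ≤ K * ∫⁻ z, ENNReal.ofReal (ψ z) ∂π := by
  -- With countably many pieces this choice raises no measurability question, and `bind` commutes
  -- with the sum.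
  choose γ h₁ h₂ h₃ using h
  have hmeas : ∀ j, MeasurableSet (L ⁻¹' {j}) := fun j => hL (measurableSet_singleton j)
  have hsum : Measure.sum (fun j => π.restrict (L ⁻¹' {j})) = π := by
    rw [← Measure.restrict_iUnion _ hmeas]
    · rw [← preimage_iUnion, iUnion_of_singleton, preimage_univ, Measure.restrict_univ]
    · intro i j hij
      exact Disjoint.preimage L (by simpa using hij)
  have e₁ : (Measure.sum γ).fst = μ₁.bind P := by
    rw [Measure.fst_sum, ← hπ.2.1, ← hsum, Measure.fst_sum,
      Measure.bind_sum _ _ P.measurable.aemeasurable]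
    simp only [h₁]
  have e₂ : (Measure.sum γ).snd = μ₂.bind P := by
    rw [Measure.snd_sum, ← hπ.2.2, ← hsum, Measure.snd_sum,
      Measure.bind_sum _ _ P.measurable.aemeasurable]
    simp only [h₂]
  have hμ₁ : IsProbabilityMeasure μ₁ := by
    have := hπ.1
    rw [← hπ.2.1]; infer_instance
  have hγ : IsProbabilityMeasure (Measure.sum γ) := by
    constructor
    rw [← Measure.fst_univ, e₁, Measure.bind_apply MeasurableSet.univ P.measurable.aemeasurable]
    simp
  refine (iInf₂_le (Measure.sum γ) ⟨hγ, e₁, e₂⟩).trans ?_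
  conv_rhs => rw [← hsum]
  rw [lintegral_sum_measure, lintegral_sum_measure, ← ENNReal.tsum_mul_left]
  exact ENNReal.tsum_le_tsum h₃

end Couplings

/-! ### Separation of measures and concave powers of the cost -/

section Polish

variable {S : Type*} [TopologicalSpace S] [PolishSpace S] [MeasurableSpace S] [BorelSpace S]

/-- The Kantorovich semi-distance separates probability measures. -/
lemma eq_of_kantorovich_eq_zero {φ : S × S → ℝ} (hφ : IsSemiDistance φ) {μ ν : Measure S}
    [IsProbabilityMeasure μ] [IsProbabilityMeasure ν] (h : kantorovich φ μ ν = 0) : μ = ν := by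
  let _ := TopologicalSpace.upgradeIsCompletelyMetrizable S
  have key : ∀ K U : Set S, IsCompact K → IsOpen U → K ⊆ U → μ K ≤ ν U := by
    intro K U hK hU hKU
    refine ENNReal.le_of_forall_pos_le_add fun ε hε _ => ?_
    obtain ⟨L, -, hL, hLε⟩ := MeasurableSet.univ.exists_isCompact_sdiff_lt (μ := ν)
      (measure_ne_top ν _) (ε := ε) (by simpa using hε.ne')
    have hC : IsCompact (K ×ˢ (L \ U)) := hK.prod (hL.diff hU)
    -- A lower semi-continuous function attains its minimum on a compact set, and this one misses
    -- the diagonal because `K ⊆ U`. Mass sent from `K` to `L \ U` therefore costs at least `m` per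
    -- unit.
    obtain ⟨m, hm, hmφ⟩ : ∃ m : ℝ, 0 < m ∧ ∀ z ∈ K ×ˢ (L \ U), m ≤ φ z := by
      rcases (K ×ˢ (L \ U)).eq_empty_or_nonempty with he | hne
      · exact ⟨1, one_pos, by simp [he]⟩
      · obtain ⟨z, hz, hmin⟩ := (hφ.lsc.lowerSemicontinuousOn _).exists_isMinOn hne hC
        refine ⟨φ z, lt_of_le_of_ne (hφ.nonneg z) fun h0 => ?_, fun w hw => hmin hw⟩
        have : z.1 = z.2 := (hφ.eq_zero_iff z.1 z.2).1 h0.symm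
        exact hz.2.2 (this ▸ hKU hz.1)
    have hcoup : ∀ π ∈ couplings μ ν, ENNReal.ofReal m * (μ K - (ν U + ε)) ≤
        ∫⁻ z, ENNReal.ofReal (φ z) ∂π := by
      intro π hπ
      have hμK : μ K = π (Prod.fst ⁻¹' K) := by
        rw [← hπ.2.1, Measure.fst_apply hK.measurableSet]
      have hνU : ν U = π (Prod.snd ⁻¹' U) := by
        rw [← hπ.2.2, Measure.snd_apply hU.measurableSet]
      have hνL : ν (univ \ L) = π (Prod.snd ⁻¹' (univ \ L)) := by
        rw [← hπ.2.2, Measure.snd_apply (MeasurableSet.univ.diff hL.measurableSet)]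
      have hcover : (Prod.fst ⁻¹' K : Set (S × S)) ⊆
          K ×ˢ (L \ U) ∪ (Prod.snd ⁻¹' U ∪ Prod.snd ⁻¹' (univ \ L)) := by
        rintro ⟨x, y⟩ hx
        simp only [mem_preimage, mem_union, mem_prod, mem_sdiff, mem_univ, true_and] at hx ⊢
        tauto
      have hle : μ K - (ν U + ε) ≤ π (K ×ˢ (L \ U)) := by
        rw [tsub_le_iff_right]
        calc μ K ≤ π (K ×ˢ (L \ U)) + (π (Prod.snd ⁻¹' U) + π (Prod.snd ⁻¹' (univ \ L))) := by
              rw [hμK]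
              refine (measure_mono hcover).trans ((measure_union_le _ _).trans ?_)
              gcongr
              exact measure_union_le _ _
          _ ≤ _ := by
              rw [← hνU, ← hνL]
              gcongr
      calc ENNReal.ofReal m * (μ K - (ν U + ε)) ≤ ENNReal.ofReal m * π (K ×ˢ (L \ U)) := by
            gcongr
        _ ≤ ∫⁻ z in K ×ˢ (L \ U), ENNReal.ofReal (φ z) ∂π := by
            rw [← setLIntegral_const]
            exact setLIntegral_mono' hC.measurableSet fun z hz =>
              ENNReal.ofReal_le_ofReal (hmφ z hz)
        _ ≤ _ := setLIntegral_le_lintegral _ _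
    have h0 : ENNReal.ofReal m * (μ K - (ν U + ε)) ≤ 0 := h ▸ le_iInf₂ hcoup
    rcases mul_eq_zero.1 (le_antisymm h0 zero_le) with h1 | h1
    · exact absurd (ENNReal.ofReal_eq_zero.1 h1) (not_le.2 hm)
    · exact tsub_eq_zero_iff_le.1 h1
  have hK : ∀ K, IsCompact K → μ K ≤ ν K := fun K hK => by
    rw [K.measure_eq_iInf_isOpen ν]
    exact le_iInf₂ fun U hKU => le_iInf fun hU => key K U hK hU hKU
  have hle : μ ≤ ν := Measure.le_iff.2 fun A hA => by
    rw [hA.measure_eq_iSup_isCompact_of_ne_top (measure_ne_top μ A)]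
    exact iSup₂_le fun K hKA => iSup_le fun hKc => (hK K hKc).trans (measure_mono hKA)
  exact Measure.eq_of_le_of_measure_univ_eq hle (by simp)

lemma kantorovich_bind_le_dobrushin_mul_of_isVSemiDistance {V : S → ℝ} (hV : Measurable V)
    (hV0 : ∀ x, 0 ≤ V x) {P : Kernel S S} [IsMarkovKernel P] {φ : S × S → ℝ}
    (hφ : IsVSemiDistance V φ) {μ₁ μ₂ : Measure S} (h₁ : μ₁ ∈ probV V) (h₂ : μ₂ ∈ probV V) :
    kantorovich φ (μ₁.bind P) (μ₂.bind P) ≤ dobrushin V P φ * kantorovich φ μ₁ μ₂ := by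
  obtain ⟨C, hC⟩ := hφ.bound
  -- The supremum ignores pairs at cost zero; separation makes such pairs equal.
  by_cases h0 : kantorovich φ μ₁ μ₂ = 0
  · have := h₁.1
    have := h₂.1
    obtain rfl := eq_of_kantorovich_eq_zero hφ.toIsSemiDistance h0
    have : IsProbabilityMeasure (μ₁.bind P) := by
      constructor
      rw [Measure.bind_apply MeasurableSet.univ P.measurable.aemeasurable]
      simp
    rw [kantorovich_self_eq_zero hφ.lsc.measurable fun x => (hφ.eq_zero_iff x x).2 rfl]
    exact zero_le
  · exact kantorovich_bind_le_dobrushin_mul h₁ h₂ h0 (kantorovich_lt_top hV hV0 hC h₁ h₂).ne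

/-- The part of a coupling on which the cost is nearly constant can be transported with a
controlled concave cost. -/
lemma exists_transport_of_level {V : S → ℝ} (hV : Measurable V)
    (hV0 : ∀ x, 0 ≤ V x) {P : Kernel S S} [IsMarkovKernel P] {φ : S × S → ℝ}
    (hφ : IsVSemiDistance V φ) {ι : ℝ} (hι : 0 < ι) (hι' : ι ≤ 1) {μ₁ μ₂ : Measure S}
    (h₁ : μ₁ ∈ probV V) (h₂ : μ₂ ∈ probV V) {π : Measure (S × S)} (hπ : π ∈ couplings μ₁ μ₂)
    {A : Set (S × S)} (hA : MeasurableSet A) {b c r : ℝ} (hb : dobrushin V P φ < ENNReal.ofReal b)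
    (hc : 0 < c) (hr : 0 < r) (hlo : ∀ z ∈ A, r ≤ φ z) (hhi : ∀ z ∈ A, φ z ≤ c * r) :
    ∃ γ : Measure (S × S), γ.fst = (π.restrict A).fst.bind P ∧
      γ.snd = (π.restrict A).snd.bind P ∧
      ∫⁻ z, ENNReal.ofReal (φ z ^ ι) ∂γ ≤
        ENNReal.ofReal (b * c) ^ ι * ∫⁻ z in A, ENNReal.ofReal (φ z ^ ι) ∂π := by
  have := hπ.1
  have hb0 : 0 < b := by
    by_contra hb'
    rw [ENNReal.ofReal_of_nonpos (not_lt.1 hb')] at hb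
    exact not_lt_zero hb
  by_cases hw : π A = 0
  · refine ⟨0, ?_, ?_, by simp⟩ <;> simp [Measure.restrict_eq_zero.2 hw, Measure.fst, Measure.snd]
  have hw' : π A ≠ ∞ := measure_ne_top π A
  set ρ := (π A)⁻¹ • π.restrict A with hρ
  have hρA : π.restrict A = π A • ρ := by
    rw [hρ, smul_smul, ENNReal.mul_inv_cancel hw hw', one_smul]
  have hρp : IsProbabilityMeasure ρ := ⟨by simp [hρ, ENNReal.inv_mul_cancel hw hw']⟩
  have hint : ∀ f : S × S → ℝ≥0∞, ∫⁻ z, f z ∂ρ ≤ (π A)⁻¹ * ∫⁻ z, f z ∂π := fun f => by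
    rw [hρ, lintegral_smul_measure, smul_eq_mul]
    gcongr 1
    exact setLIntegral_le_lintegral _ _
  have hw₁ : ρ.fst ∈ probV V := by
    refine ⟨inferInstance, ?_⟩
    rw [Measure.fst, lintegral_map hV.ennreal_ofReal measurable_fst]
    refine (hint _).trans_lt (ENNReal.mul_lt_top (by simpa [pos_iff_ne_zero] using hw) ?_)
    rw [← lintegral_map hV.ennreal_ofReal measurable_fst]
    have := h₁.2
    rwa [← hπ.2.1] at this
  have hw₂ : ρ.snd ∈ probV V := by
    refine ⟨inferInstance, ?_⟩
    rw [Measure.snd, lintegral_map hV.ennreal_ofReal measurable_snd]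
    refine (hint _).trans_lt (ENNReal.mul_lt_top (by simpa [pos_iff_ne_zero] using hw) ?_)
    rw [← lintegral_map hV.ennreal_ofReal measurable_snd]
    have := h₂.2
    rwa [← hπ.2.2] at this
  have hcost : kantorovich φ ρ.fst ρ.snd ≤ ENNReal.ofReal (c * r) := by
    refine (iInf₂_le ρ ⟨hρp, rfl, rfl⟩).trans ?_
    rw [hρ, lintegral_smul_measure, smul_eq_mul]
    calc (π A)⁻¹ * ∫⁻ z in A, ENNReal.ofReal (φ z) ∂π
        ≤ (π A)⁻¹ * ∫⁻ _ in A, ENNReal.ofReal (c * r) ∂π := by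
          gcongr 1
          exact setLIntegral_mono' hA fun z hz => ENNReal.ofReal_le_ofReal (hhi z hz)
      _ = ENNReal.ofReal (c * r) := by
          rw [setLIntegral_const, mul_left_comm, ENNReal.inv_mul_cancel hw hw', mul_one]
  have hcr : 0 < c * r := mul_pos hc hr
  -- Strictness, from `b` being above the coefficient and `c * r > 0`, yields an actual coupling
  -- below the bound even if the infimum is not attained.
  have hlt : kantorovich (fun z => φ z ^ ι) (ρ.fst.bind P) (ρ.snd.bind P) <
      (ENNReal.ofReal b * ENNReal.ofReal (c * r)) ^ ι := by
    refine (kantorovich_rpow_le hφ.lsc.measurable hφ.nonneg hι hι' _ _).trans_lt ?_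
    refine ENNReal.rpow_lt_rpow ?_ hι
    refine (kantorovich_bind_le_dobrushin_mul_of_isVSemiDistance hV hV0 hφ hw₁ hw₂).trans_lt ?_
    refine (mul_le_mul_right hcost _).trans_lt ?_
    exact ENNReal.mul_lt_mul_left (by simpa using hcr) ENNReal.ofReal_ne_top hb
  obtain ⟨γ, hγ⟩ := iInf_lt_iff.1 hlt
  obtain ⟨hγc, hγ⟩ := iInf_lt_iff.1 hγ
  refine ⟨π A • γ, ?_, ?_, ?_⟩
  · rw [hρA, Measure.fst, Measure.fst, Measure.map_smul, Measure.map_smul, Measure.bind_smul]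
    exact congrArg _ hγc.2.1
  · rw [hρA, Measure.snd, Measure.snd, Measure.map_smul, Measure.map_smul, Measure.bind_smul]
    exact congrArg _ hγc.2.2
  · rw [lintegral_smul_measure, smul_eq_mul]
    calc π A * ∫⁻ z, ENNReal.ofReal (φ z ^ ι) ∂γ
        ≤ π A * (ENNReal.ofReal b * ENNReal.ofReal (c * r)) ^ ι := by gcongr
      _ = ENNReal.ofReal (b * c) ^ ι * ∫⁻ _ in A, ENNReal.ofReal (r ^ ι) ∂π := by
          rw [setLIntegral_const, ← ENNReal.ofReal_mul hb0.le, ← mul_assoc,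
            ENNReal.ofReal_mul (mul_pos hb0 hc).le, ENNReal.mul_rpow_of_nonneg _ _ hι.le,
            ENNReal.ofReal_rpow_of_nonneg hr.le hι.le]
          ring
      -- The lower level bound turns `r ^ ι` times the mass of `A` back into the cost of the piece.
      _ ≤ _ := by
          gcongr 1
          refine setLIntegral_mono' hA fun z hz => ENNReal.ofReal_le_ofReal ?_
          exact Real.rpow_le_rpow hr.le (hlo z hz) hι.le

/-- The part of a coupling carried by the zero set of the cost is transported at no cost. -/
lemma exists_transport_of_zero {P : Kernel S S} {φ : S × S → ℝ}
    (hφ : IsSemiDistance φ) {ι : ℝ} (hι : 0 < ι) {π : Measure (S × S)}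
    {A : Set (S × S)} (hA : MeasurableSet A) (h0 : ∀ z ∈ A, φ z = 0) :
    ∃ γ : Measure (S × S), γ.fst = (π.restrict A).fst.bind P ∧
      γ.snd = (π.restrict A).snd.bind P ∧ ∫⁻ z, ENNReal.ofReal (φ z ^ ι) ∂γ = 0 := by
  have hm : Measurable fun x : S => (x, x) := measurable_id.prodMk measurable_id
  have hfs : (π.restrict A).fst = (π.restrict A).snd := by
    refine Measure.map_congr ?_
    filter_upwards [ae_restrict_mem hA] with z hz
    exact (hφ.eq_zero_iff z.1 z.2).1 (h0 z hz)
  refine ⟨((π.restrict A).fst.bind P).map fun x => (x, x), ?_, ?_, ?_⟩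
  · rw [Measure.fst, Measure.map_map measurable_fst hm]; exact Measure.map_id
  · rw [Measure.snd, Measure.map_map measurable_snd hm, hfs]; exact Measure.map_id
  · rw [lintegral_map (hφ.lsc.measurable.pow_const ι).ennreal_ofReal hm]
    simp [(hφ.eq_zero_iff _ _).2 rfl, Real.zero_rpow hι.ne']

/-- Concave powers of the cost contract at least at the corresponding power of the rate. -/
lemma dobrushin_rpow_le {V : S → ℝ} (hV : Measurable V)
    (hV0 : ∀ x, 0 ≤ V x) (P : Kernel S S) [IsMarkovKernel P] {φ : S × S → ℝ}
    (hφ : IsVSemiDistance V φ) {ι : ℝ} (hι : 0 < ι) (hι' : ι ≤ 1) :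
    dobrushin V P (fun z => φ z ^ ι) ≤ dobrushin V P φ ^ ι := by
  rw [← ENNReal.rpow_inv_le_iff hι]
  refine le_of_forall_gt_imp_ge_of_dense fun B hB => ?_
  rcases eq_or_ne B ∞ with rfl | hBtop
  · exact le_top
  obtain ⟨b', hb, hbB⟩ := exists_between hB
  have hb'0 : b' ≠ 0 := (pos_of_gt hb).ne'
  lift b' to ℝ≥0 using hbB.ne_top
  lift B to ℝ≥0 using hBtop
  have hb0 : (0 : ℝ) < b' := by exact_mod_cast pos_iff_ne_zero.2 (by exact_mod_cast hb'0)
  have hbB' : (b' : ℝ) < B := by exact_mod_cast hbB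
  have hB0 : (0 : ℝ) < B := hb0.trans hbB'
  -- The level ratio $e^t$ uses up exactly the gap between `b'` and `B`.
  set t := Real.log (B / b') with ht
  have ht0 : 0 < t := Real.log_pos ((one_lt_div hb0).2 hbB')
  have hexp : Real.exp t = B / b' := Real.exp_log (div_pos hB0 hb0)
  have hK : ENNReal.ofReal (b' * Real.exp t) = B := by
    rw [hexp, mul_div_cancel₀ _ hb0.ne', ENNReal.ofReal_coe_nnreal]
  have hBne : (B : ℝ≥0∞) ≠ 0 := by exact_mod_cast hB0.ne'
  rw [ENNReal.rpow_inv_le_iff hι]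
  refine dobrushin_le fun μ₁ h₁ μ₂ h₂ _ => ?_
  refine le_mul_kantorovich (by simp [hBne]) (by simp [hι.le])
    fun π hπ => ?_
  have hφm : Measurable φ := hφ.lsc.measurable
  -- The second label is needed since `Real.log 0 = 0` would put the zero set of `φ` in level 0.
  have hL : Measurable fun z => (⌊Real.log (φ z) / t⌋, φ z = 0) :=
    ((Real.measurable_log.comp hφm).div_const t).floor.prodMk
      (measurableSet_setOfPred.1 (hφm (measurableSet_singleton 0)))
  refine kantorovich_bind_le_of_pieces hL hπ ?_
  rintro ⟨k, p⟩
  have hA := hL (measurableSet_singleton (k, p))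
  by_cases hp : p
  · obtain ⟨γ, e₁, e₂, e₃⟩ := exists_transport_of_zero (P := P) (π := π) hφ.toIsSemiDistance hι hA
      fun z hz => by
        have := congrArg Prod.snd hz
        exact this.mpr hp
    exact ⟨γ, e₁, e₂, e₃.le.trans zero_le⟩
  · have hlev : ∀ z ∈ (fun z => (⌊Real.log (φ z) / t⌋, φ z = 0)) ⁻¹' {(k, p)},
        Real.exp (k * t) ≤ φ z ∧ φ z ≤ Real.exp t * Real.exp (k * t) := by
      intro z hz
      have hk : ⌊Real.log (φ z) / t⌋ = k := congrArg Prod.fst hz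
      have hz0 : φ z ≠ 0 := fun h0 => hp ((congrArg Prod.snd hz : (φ z = 0) = p).mp h0)
      have hpos : 0 < φ z := lt_of_le_of_ne (hφ.nonneg z) hz0.symm
      obtain ⟨hl, hu⟩ := Int.floor_eq_iff.1 hk
      rw [le_div_iff₀ ht0] at hl
      rw [div_lt_iff₀ ht0] at hu
      rw [← Real.exp_add, ← Real.le_log_iff_exp_le hpos, ← Real.log_le_iff_le_exp hpos]
      exact ⟨hl, by linarith⟩
    have := exists_transport_of_level hV hV0 hφ hι hι' h₁ h₂ hπ hA (b := b') (c := Real.exp t)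
      (r := Real.exp (k * t)) (by rwa [ENNReal.ofReal_coe_nnreal]) (Real.exp_pos _)
      (Real.exp_pos _) (fun z hz => (hlev z hz).1) fun z hz => (hlev z hz).2
    rwa [hK] at this

end Polish

end KantorovichContraction

/-! ### Assembly of the three items -/

theorem mainTheorem6 {S : Type*} [MetricSpace S] [CompleteSpace S]
    [TopologicalSpace.SeparableSpace S] [MeasurableSpace S] [BorelSpace S]
    (V : S → ℝ) (hV : KantorovichContraction.IsWeight V)
    (P : Kernel S S) [IsMarkovKernel P] (hP : KantorovichContraction.IsVOperator V P)
    (φ : S × S → ℝ) (hφ : KantorovichContraction.IsVSemiDistance V φ) :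
    (∀ a : ℝ, 0 < a →
      KantorovichContraction.dobrushin V P (fun z => a * φ z) =
        KantorovichContraction.dobrushin V P φ) ∧
    (∀ ι : ℝ, 0 < ι → ι ≤ 1 →
      KantorovichContraction.dobrushin V P (fun z => φ z ^ ι) ≤
        KantorovichContraction.dobrushin V P φ ^ ι) ∧
    (∀ ψ : S × S → ℝ, KantorovichContraction.IsVSemiDistance V ψ →
      ∀ a b : ℝ, 0 < a → a ≤ b → (∀ z, a * φ z ≤ ψ z) → (∀ z, ψ z ≤ b * φ z) →
        KantorovichContraction.dobrushin V P φ ≤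
          ENNReal.ofReal (b / a) * KantorovichContraction.dobrushin V P ψ) ∧
    (∀ ψ : S × S → ℝ, KantorovichContraction.IsVSemiDistance V ψ → (∀ z, φ z ≤ ψ z) →
      KantorovichContraction.dobrushin V P ψ < 1 →
        (∀ ι δ : ℝ, 0 ≤ ι → 0 < δ → δ < 1 →
          KantorovichContraction.dobrushin V P ψ < ENNReal.ofReal (δ / (1 + ι)) →
          KantorovichContraction.dobrushin V P (fun z => ι * φ z + ψ z) ≤ ENNReal.ofReal δ) ∧
        (∀ ι : ℝ, 0 ≤ ι →
          ENNReal.ofReal ι ≤ 1 - KantorovichContraction.dobrushin V P ψ →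
          KantorovichContraction.dobrushin V P (fun z => ι * φ z + ψ z) ≤
            1 - (1 - KantorovichContraction.dobrushin V P ψ) ^ 2)) := by
  have : SecondCountableTopology S := UniformSpace.secondCountable_of_separable S
  obtain ⟨v, hv, hvV⟩ := hV.bddBelow_pos
  have hVm : Measurable V := hV.lsc.measurable
  have hV0 : ∀ x, 0 ≤ V x := fun x => hv.le.trans (hvV x)
  obtain ⟨C, hC⟩ := hφ.bound
  refine ⟨fun a ha => le_antisymm ?_ ?_,
    fun ι hι hι' => KantorovichContraction.dobrushin_rpow_le hVm hV0 P hφ hι hι', ?_, ?_⟩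
  · have h := KantorovichContraction.dobrushin_le_of_equiv hVm hV0 P (φ := fun z => a * φ z) hC
      (inv_pos.2 ha) (inv_pos.2 ha) (fun z => (inv_mul_cancel_left₀ ha.ne' (φ z)).le)
      (fun z => (inv_mul_cancel_left₀ ha.ne' (φ z)).ge)
    rwa [div_self (inv_pos.2 ha).ne', ENNReal.ofReal_one, one_mul] at h
  · have h := KantorovichContraction.dobrushin_le_of_equiv hVm hV0 P (φ := φ)
      (ψ := fun z => a * φ z) (C := a * C)
      (fun x y => by rw [mul_assoc]; exact mul_le_mul_of_nonneg_left (hC x y) ha.le) ha ha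
      (fun z => le_rfl) (fun z => le_rfl)
    rwa [div_self ha.ne', ENNReal.ofReal_one, one_mul] at h
  · intro ψ hψ a b ha hab hl hu
    obtain ⟨C', hC'⟩ := hψ.bound
    exact KantorovichContraction.dobrushin_le_of_equiv hVm hV0 P hC' ha (ha.trans_le hab) hl hu
  · intro ψ hψ hle hlt
    obtain ⟨C', hC'⟩ := hψ.bound
    have key : ∀ ι : ℝ, 0 ≤ ι → KantorovichContraction.dobrushin V P (fun z => ι * φ z + ψ z) ≤
        ENNReal.ofReal (1 + ι) * KantorovichContraction.dobrushin V P ψ := by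
      intro ι hι
      have hι1 : 0 < 1 + ι := by linarith
      have h := KantorovichContraction.dobrushin_le_of_equiv hVm hV0 P
        (φ := fun z => ι * φ z + ψ z) hC' (inv_pos.2 hι1) one_pos
        (fun z => by
          rw [inv_mul_le_iff₀ hι1]
          nlinarith [mul_le_mul_of_nonneg_left (hle z) hι])
        (fun z => by
          rw [one_mul]
          exact le_add_of_nonneg_left (mul_nonneg hι (hφ.nonneg z)))
      rwa [one_div, inv_inv] at h
    refine ⟨fun ι δ hι hδ _ h => (key ι hι).trans ?_, fun ι hι h => (key ι hι).trans ?_⟩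
    · have hι1 : 0 < 1 + ι := by linarith
      calc ENNReal.ofReal (1 + ι) * KantorovichContraction.dobrushin V P ψ
          ≤ ENNReal.ofReal (1 + ι) * ENNReal.ofReal (δ / (1 + ι)) := by gcongr
        _ = ENNReal.ofReal δ := by
          rw [← ENNReal.ofReal_mul hι1.le, mul_div_cancel₀ _ hι1.ne']
    · generalize KantorovichContraction.dobrushin V P ψ = β at hlt h
      lift β to ℝ≥0 using hlt.ne_top
      have hβ : β ≤ 1 := by exact_mod_cast hlt.le
      lift ι to ℝ≥0 using hι
      rw [ENNReal.ofReal_coe_nnreal] at h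
      rw [ENNReal.ofReal_add zero_le_one ι.coe_nonneg, ENNReal.ofReal_one, ENNReal.ofReal_coe_nnreal]
      norm_cast at h ⊢
      rw [← NNReal.coe_le_coe, NNReal.coe_sub hβ] at h
      have h1 : (1 - β) ^ 2 ≤ 1 := pow_le_one₀ zero_le tsub_le_self
      rw [← NNReal.coe_le_coe, NNReal.coe_sub h1]
      push_cast [NNReal.coe_sub hβ] at h ⊢
      -- From $\iota\le1-\beta$: $(1+\iota)\beta\le(2-\beta)\beta=1-(1-\beta)^2$.
      nlinarith [mul_le_mul_of_nonneg_right h β.2]
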